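/- **Setting.** Let $\mathbb R_+=[0,\infty)$. An *impulsive semidynamical system* $(X,\pi;M,I)$ consists of a metric space $(X,\rho)$, a continuous map $\pi:X\times\mathbb R_+\to X$ with $\pi(x,0)=x$ and $\pi(\pi(x,t),s)=\pi(x,t+s)$, a nonempty closed set $M\subset X$ such that every $x\in M$ admits $\epsilon_x>0$ with $\pi(x,t)\notin M$ and $\{y\in M:\pi(y,t)=x\}=\emptyset$ for all $0<t<\epsilon_x$, and a continuous map $I:M\to X$. For $x\in X$ let $\phi(x)\in(0,+\infty]$ be the least $s>0$ with $\pi(x,s)\in M$ ($+\infty$ if there is none). Put $x_0^+=x$, $s_n=\phi(x_n^+)$ and, as long as $s_n<\infty$, $x_{n+1}^+=I(\pi(x_n^+,s_n))$. With $t_n=\sum_{i<n}s_i$, the impulsive trajectory is $\tilde\pi(x,t)=\pi(x_n^+,t-t_n)$ for $t_n\le t<t_{n+1}$; it is defined on $[0,T(x))$, where $T(x)=\sum_i s_i$ (and $T(x)=+\infty$ if some $s_n=+\infty$). For $D\subset X$ and $\Delta\subset\mathbb R_+$ write $F(D,\Delta)=\{y\in X:\pi(y,t)\in D\text{ for some }t\in\Delta\}$,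 and $F(D,t)=F(D,\{t\})$. The following conditions are assumed: * (H1) for every $x\in M$ there are $t>0$ and $y\in X$ with $\pi(y,t)=x$; and for every $x\in M$ there are $\lambda>0$ and closed sets $S,L\subset X$ with $x\in S$ such that $F(L,\lambda)=S$, the set $F(L,[0,2\lambda])$ is a neighborhood of $x$, $F(L,\mu)\cap F(L,\nu)=\emptyset$ for $0\le\mu<\nu\le2\lambda$, and $S=M\cap F(L,[0,2\lambda])$; * (H2) $M\cap I(M)=\emptyset$; * (H3) $T(x)=+\infty$ for every $x\in X$. A point $p\in X$ is *stationary* if $\tilde\pi(p,t)=p$ for all $t\ge0$; *$\tilde\pi$-periodic* if $\tilde\pi(p,\tau)=p$ for some $\tau>0$; *almost $\tilde\pi$-periodic* if for every $\epsilon>0$ there is $T>0$ such that for every $\alpha\ge0$ there is $\tau\in[\alpha,\alpha+T]$, $\tau>0$, with $\rho(\tilde\pi(p,t+\tau),\tilde\pi(p,t))<\epsilon$ for all $t\ge0$. A point $x\in X$ is *asymptotically $\tilde\pi$-stationary* (respectively *asymptotically $\tilde\pi$-periodic*, *asymptotically almost $\tilde\pi$-periodic*) if there are a stationary (respectively $\tilde\pi$-periodic,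 almost $\tilde\pi$-periodic) point $p\in X$ and a homeomorphism $g:\mathbb R_+\to\mathbb R_+$ with $g(0)=0$ such that $\lim_{t\to+\infty}\rho(\tilde\pi(x,t),\tilde\pi(p,g(t)))=0$. Let $\mathcal L_x^{+\infty}$ be the set of sequences $(t_n)$ in $\mathbb R_+$ with $t_n\to+\infty$ for which $(\tilde\pi(x,t_n))$ converges to some point of $X$. Given two such systems $(X,\pi;M_X,I_X)$ and $(Y,\sigma;M_Y,I_Y)$, a point $y\in Y$ is *comparable in limit* with $x\in X$ if $\mathcal L_x^{+\infty}\subset\mathcal L_y^{+\infty}$. **Theorem 4.18.** Let $(X,\pi;M_X,I_X)$ and $(Y,\sigma;M_Y,I_Y)$ be impulsive semidynamical systems satisfying (H1), (H2) and (H3), with $X$ complete. Let $x\in X$, and let $y\in Y$ be comparable in limit with $x$. If $x$ is asymptotically almost $\tilde\pi$-periodic (respectively asymptotically $\tilde\pi$-stationary, asymptotically $\tilde\pi$-periodic), then $y$ is asymptotically almost $\tilde\sigma$-periodic (respectively asymptotically $\tilde\sigma$-stationary, asymptotically $\tilde\sigma$-periodic). -/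

import Mathlib

open Filter Topology Set
open scoped NNReal ENNReal

/-- An impulsive semidynamical system `(X, π; M, I)`: a semidynamical system (a continuous action of
the monoid of nonnegative reals), a nonempty closed impulsive set `M` which is left by every
forward motion and, backwards in time, by every motion arriving in it, for a positive
amount of time, and a continuous impulse function `I : M → X`. -/
structure ImpulsiveSystem (X : Type*) [MetricSpace X] where
  flow : Flow ℝ≥0 X
  M : Set X
  M_nonempty : M.Nonempty
  M_closed : IsClosed M
  M_isolated : ∀ x ∈ M, ∃ ε : ℝ≥0, 0 < ε ∧
    (∀ t ∈ Ioo 0 ε, ∀ y ∈ M, flow t y ≠ x) ∧ (∀ t ∈ Ioo 0 ε, flow t x ∉ M)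
  I : M → X
  I_continuous : Continuous I

namespace ImpulsiveSystem

variable {X : Type*} [MetricSpace X] (S : ImpulsiveSystem X)

/-- `F(D, Δ)`: the points that are carried into `D` at some time in `Δ`. -/
def F (D : Set X) (Δ : Set ℝ≥0) : Set X := {y | ∃ t ∈ Δ, S.flow t y ∈ D}

/-- `x` is an initial point if `F(x, t) = ∅` for all `t > 0`. -/
def IsInitialPoint (x : X) : Prop := ∀ t : ℝ≥0, 0 < t → S.F {x} {t} = ∅

/-- The strong tube condition (STC) at `x`. Here `A` is the section through `x`, `L` the bar and
`F(L, [0, 2l])` the tube. -/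
def StrongTubeCondition (x : X) : Prop :=
  ∃ (l : ℝ≥0) (A L : Set X), 0 < l ∧ IsClosed A ∧ x ∈ A ∧ IsClosed L ∧
    S.F L {l} = A ∧
    S.F L (Icc 0 (2 * l)) ∈ 𝓝 x ∧
    (∀ μ ν : ℝ≥0, μ < ν → ν ≤ 2 * l → S.F L {μ} ∩ S.F L {ν} = ∅) ∧
    A = S.M ∩ S.F L (Icc 0 (2 * l))

/-- `φ(x)`: the least positive time at which the motion of `x` meets `M`, and `∞` if there is
no such time. -/
noncomputable def phi (x : X) : ℝ≥0∞ :=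
  ⨅ (s : ℝ≥0) (_ : 0 < s ∧ S.flow s x ∈ S.M), (s : ℝ≥0∞)

/-- If finite, the infimum defining `φ(x)` is positive and attained. -/
theorem phi_spec {x : X} (h : S.phi x ≠ ∞) :
    0 < (S.phi x).toNNReal ∧ S.flow (S.phi x).toNNReal x ∈ S.M := by
  set s := (S.phi x).toNNReal with hs
  have hcoe : ((s : ℝ≥0) : ℝ≥0∞) = S.phi x := ENNReal.coe_toNNReal h
  have hlb : ∀ u : ℝ≥0, 0 < u → S.flow u x ∈ S.M → s ≤ u := by
    intro u hu hum
    have : S.phi x ≤ (u : ℝ≥0∞) := iInf₂_le u ⟨hu, hum⟩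
    rw [← hcoe] at this
    exact_mod_cast this
  have hex : ∀ r : ℝ≥0, s < r → ∃ u : ℝ≥0, 0 < u ∧ S.flow u x ∈ S.M ∧ u < r := by
    intro r hr
    have : S.phi x < (r : ℝ≥0∞) := by rw [← hcoe]; exact_mod_cast hr
    unfold phi at this
    simp only [iInf_lt_iff] at this
    obtain ⟨u, ⟨hu, hum⟩, hur⟩ := this
    exact ⟨u, hu, hum, by exact_mod_cast hur⟩
  have hcont : Continuous fun t : ℝ≥0 => S.flow t x :=
    S.flow.continuous continuous_id continuous_const
  have hmem : S.flow s x ∈ S.M := by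
    have hcl : IsClosed {t : ℝ≥0 | S.flow t x ∈ S.M} := S.M_closed.preimage hcont
    have : s ∈ closure {t : ℝ≥0 | S.flow t x ∈ S.M} := by
      rw [Metric.mem_closure_iff]
      intro ε hε
      obtain ⟨u, hu, hum, hur⟩ := hex (s + ⟨ε, hε.le⟩)
        (lt_add_of_pos_right _ (by exact_mod_cast hε))
      refine ⟨u, hum, ?_⟩
      have h1 : (s : ℝ) ≤ u := by exact_mod_cast hlb u hu hum
      have h2 : (u : ℝ) < s + ε := by exact_mod_cast hur
      rw [NNReal.dist_eq, abs_lt]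
      constructor <;> linarith
    rwa [hcl.closure_eq] at this
  refine ⟨?_, hmem⟩
  by_contra h0
  have hs0 : s = 0 := by simpa using h0
  rw [hs0] at hmem hex
  have hx : x ∈ S.M := by simpa using hmem
  obtain ⟨ε, hε, -, h2⟩ := S.M_isolated x hx
  obtain ⟨u, hu, hum, hur⟩ := hex ε hε
  exact h2 u ⟨hu, hur⟩ hum

open Classical in
/-- The point from which the impulsive motion of `x` restarts after its first impulse,
`I(π(x, φ(x)))`; the value is irrelevant if `φ(x) = ∞`. -/
noncomputable def restart (x : X) : X :=
  if h : S.phi x ≠ ∞ then S.I ⟨S.flow (S.phi x).toNNReal x, (S.phi_spec h).2⟩ else x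

/-- `t_n(x) = s_0 + ⋯ + s_{n-1}` with `s_i = φ(x_i⁺)` and `x_i⁺` the point after `i` impulses;
it is infinite as soon as fewer than `n` impulses occur. -/
noncomputable def impulseTime (x : X) (n : ℕ) : ℝ≥0∞ :=
  ∑ i ∈ Finset.range n, S.phi (S.restart^[i] x)

/-- `T(x)`, the length of the interval on which the impulsive motion of `x` is defined. -/
noncomputable def lifetime (x : X) : ℝ≥0∞ := ∑' i : ℕ, S.phi (S.restart^[i] x)

open Classical in
/-- The impulsive trajectory `π̃(x, t)`: it equals `π(x_n⁺, t - t_n(x))` for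
`t_n(x) ≤ t < t_{n+1}(x)`. For `t ≥ T(x)`, where it is undefined, the value is a dummy. -/
noncomputable def traj (x : X) (t : ℝ≥0) : X :=
  if h : ∃ n : ℕ, (t : ℝ≥0∞) < S.impulseTime x (n + 1) then
    S.flow (t - (S.impulseTime x (Nat.find h)).toNNReal) (S.restart^[Nat.find h] x)
  else x

/-- The standing assumptions (H1), (H2), (H3). -/
structure Standing : Prop where
  not_initial : ∀ x ∈ S.M, ¬ S.IsInitialPoint x
  tube : ∀ x ∈ S.M, S.StrongTubeCondition x
  disjoint : S.M ∩ range S.I = ∅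
  global : ∀ x, S.lifetime x = ∞

/-- `x` is stationary. -/
def IsStationary (x : X) : Prop := ∀ t : ℝ≥0, S.traj x t = x

/-- `x` is `π̃`-periodic. -/
def IsPeriodic (x : X) : Prop := ∃ τ : ℝ≥0, 0 < τ ∧ S.traj x τ = x

/-- `x` is almost `π̃`-periodic. -/
def IsAlmostPeriodic (x : X) : Prop :=
  ∀ ε : ℝ, 0 < ε → ∃ T : ℝ≥0, 0 < T ∧ ∀ α : ℝ≥0, ∃ τ ∈ Icc α (α + T), 0 < τ ∧
    ∀ t : ℝ≥0, dist (S.traj x (t + τ)) (S.traj x t) < ε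

/-- The motion of `x` is asymptotic to that of `p`, up to a time reparametrization. -/
def IsAsymptoticTo (x p : X) : Prop :=
  ∃ g : ℝ≥0 ≃ₜ ℝ≥0, g 0 = 0 ∧
    Tendsto (fun t : ℝ≥0 => dist (S.traj x t) (S.traj p (g t))) atTop (𝓝 0)

/-- `x` is asymptotically `π̃`-stationary. -/
def IsAsymptoticallyStationary (x : X) : Prop :=
  ∃ p, S.IsStationary p ∧ S.IsAsymptoticTo x p

/-- `x` is asymptotically `π̃`-periodic. -/
def IsAsymptoticallyPeriodic (x : X) : Prop :=
  ∃ p, S.IsPeriodic p ∧ S.IsAsymptoticTo x p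

/-- `x` is asymptotically almost `π̃`-periodic. -/
def IsAsymptoticallyAlmostPeriodic (x : X) : Prop :=
  ∃ p, S.IsAlmostPeriodic p ∧ S.IsAsymptoticTo x p

/-- `𝓛_{z,p}^{+∞}`: the time sequences tending to `+∞` along which the impulsive motion of `z`
converges to `p`. -/
def convSeqTo (z p : X) : Set (ℕ → ℝ≥0) :=
  {t | Tendsto (fun n => S.traj z (t n)) atTop (𝓝 p) ∧ Tendsto t atTop atTop}

/-- `𝓛_z^{+∞}`: the union of the sets `𝓛_{z,p}^{+∞}` over all points `p`. -/
def convSeq (z : X) : Set (ℕ → ℝ≥0) := ⋃ p : X, S.convSeqTo z p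

end ImpulsiveSystem

/-- `y` is comparable in limit with `x`. -/
def ComparableInLimit {X Y : Type*} [MetricSpace X] [MetricSpace Y]
    (SX : ImpulsiveSystem X) (SY : ImpulsiveSystem Y) (y : Y) (x : X) : Prop :=
  SX.convSeq x ⊆ SY.convSeq y

/-! Let `p` be the almost periodic point to which `x` is asymptotic, with time change `g`. Almost
periodicity gives times `τ n → ∞` whose translates move the motion of `p` uniformly little. Along `u
n = g⁻¹ (τ n)` the motion of `x` converges to `p`, so by comparability that of `y` converges to some
`q`. This `q`, with the same `g`, is the required point.

Interleaving two sequences of times turns comparability into uniform continuity of the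
correspondence `x(t) ↦ y(t)` for large times (`ComparableInLimit.uniform`); the needed compactness
is that of the orbit closure of `p`. If `x(u n + s) → p(s)` and `y(u n + s) → q(s)`, this uniform
continuity passes to `p(s) ↦ q(s)` and transfers rest, periods and almost periods from `p` to `q`.

The obstacle is that impulsive motions depend discontinuously on the initial point, at points of `M`
and at impulse times. `Standing.limit_notMem` shows `p, q ∉ M`: an orbit accumulating at a point of
`M` would have an impulse in vanishing time and be thrown near the range of `I`, which is disjoint
from `M`. Impulse times are avoided by moving slightly to the right
(`Standing.eventually_continuousAt_traj`), and right-continuity recovers them. -/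

namespace ImpulsiveSystem

/-! ### Semigroup law, right-continuity and avoidance of `M` -/

section Basic

variable {X : Type*} [MetricSpace X] {S : ImpulsiveSystem X}

theorem exists_coe_eq {a : ℝ≥0∞} (h : a ≠ ∞) : ∃ c : ℝ≥0, (c : ℝ≥0∞) = a :=
  ⟨a.toNNReal, ENNReal.coe_toNNReal h⟩

theorem continuous_flow : Continuous fun q : X × ℝ≥0 => S.flow q.2 q.1 :=
  S.flow.continuous continuous_snd continuous_fst

theorem phi_pos (x : X) : 0 < S.phi x := by
  by_cases h : S.phi x = ∞
  · simp [h]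
  · rw [← ENNReal.coe_toNNReal h]
    exact_mod_cast (S.phi_spec h).1

theorem phi_le {x : X} {s : ℝ≥0} (hs : 0 < s) (h : S.flow s x ∈ S.M) : S.phi x ≤ s :=
  iInf₂_le s ⟨hs, h⟩

theorem flow_mem_of_phi_eq {x : X} {c : ℝ≥0} (h : S.phi x = c) : S.flow c x ∈ S.M := by
  have := (S.phi_spec (x := x) (by simp [h])).2
  simpa [h] using this

theorem phi_coe_pos {x : X} {c : ℝ≥0} (h : S.phi x = c) : 0 < c := by
  have := S.phi_pos x
  rw [h] at this
  exact_mod_cast this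

theorem flow_notMem_of_lt_phi {x : X} {s : ℝ≥0} (hs : 0 < s) (h : s < S.phi x) :
    S.flow s x ∉ S.M := fun hm => (phi_le hs hm).not_gt h

theorem restart_of_phi_eq {x : X} {c : ℝ≥0} (h : S.phi x = c) :
    S.restart x = S.I ⟨S.flow c x, flow_mem_of_phi_eq h⟩ := by
  have h' : S.phi x ≠ ∞ := by simp [h]
  rw [restart, dif_pos h']
  congr 2
  simp [h]

theorem phi_flow {x : X} {s : ℝ≥0} (hs : s < S.phi x) {c : ℝ≥0} (h : S.phi x = s + c) :
    S.phi (S.flow s x) = c := by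
  have hc : 0 < c := by
    rcases eq_or_ne c 0 with rfl | hc
    · simp [h] at hs
    · exact pos_iff_ne_zero.2 hc
  apply le_antisymm
  · apply phi_le hc
    rw [← Flow.map_add, add_comm]
    exact flow_mem_of_phi_eq (by simpa using h)
  · refine le_iInf₂ fun u hu => ?_
    have : S.phi x ≤ ((u + s : ℝ≥0) : ℝ≥0∞) :=
      phi_le (by positivity [hu.1]) (by rw [Flow.map_add]; exact hu.2)
    rw [h] at this
    have h2 : s + c ≤ u + s := by exact_mod_cast this
    have h3 : c ≤ u := by rw [add_comm] at h2; exact le_of_add_le_add_right h2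
    exact_mod_cast h3

theorem phi_flow_eq_top {x : X} {s : ℝ≥0} (h : S.phi x = ∞) : S.phi (S.flow s x) = ∞ := by
  by_contra h'
  obtain ⟨h1, h2⟩ := S.phi_spec h'
  rw [← Flow.map_add] at h2
  have := phi_le (by positivity) h2
  rw [h] at this
  exact absurd this (by simp)

theorem restart_flow {x : X} {s : ℝ≥0} (hs : s < S.phi x) {c : ℝ≥0} (h : S.phi x = s + c) :
    S.restart (S.flow s x) = S.restart x := by
  rw [restart_of_phi_eq (phi_flow hs h), restart_of_phi_eq (c := c + s) (by simp [h, add_comm])]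
  congr 2
  rw [Flow.map_add]

theorem impulseTime_mono (x : X) : Monotone (S.impulseTime x) := by
  intro m n h
  exact Finset.sum_le_sum_of_subset (Finset.range_mono h)

theorem impulseTime_succ (x : X) (n : ℕ) :
    S.impulseTime x (n + 1) = S.phi x + S.impulseTime (S.restart x) n := by
  simp [impulseTime, Finset.sum_range_succ', add_comm]

theorem traj_eq {x : X} {t : ℝ≥0} {n : ℕ} (h1 : S.impulseTime x n ≤ t)
    (h2 : t < S.impulseTime x (n + 1)) :
    S.traj x t = S.flow (t - (S.impulseTime x n).toNNReal) (S.restart^[n] x) := by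
  classical
  have h : ∃ n : ℕ, (t : ℝ≥0∞) < S.impulseTime x (n + 1) := ⟨n, h2⟩
  have hn : Nat.find h = n := by
    rw [Nat.find_eq_iff]
    exact ⟨h2, fun m hm => not_lt.2 ((impulseTime_mono x hm).trans h1)⟩
  rw [traj, dif_pos h]
  convert rfl using 3
  · rw [← hn]
  · rw [← hn]

theorem traj_of_lt {x : X} {t : ℝ≥0} (h : t < S.phi x) : S.traj x t = S.flow t x := by
  rw [traj_eq (n := 0)] <;> simp [impulseTime, h]

theorem traj_zero (x : X) : S.traj x 0 = x := by
  rw [traj_of_lt (by simpa using phi_pos x), Flow.map_zero_apply]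

theorem Standing.exists_lt_impulseTime (hS : S.Standing) (x : X) (t : ℝ≥0) :
    ∃ n, t < S.impulseTime x n := by
  have := hS.global x
  rw [lifetime, ENNReal.tsum_eq_iSup_nat] at this
  exact lt_iSup_iff.1 (this ▸ ENNReal.coe_lt_top)

theorem Standing.traj_add (hS : S.Standing) {x : X} {c : ℝ≥0} (h : S.phi x = c) (t : ℝ≥0) :
    S.traj x (c + t) = S.traj (S.restart x) t := by
  classical
  obtain ⟨n, hn, hlt⟩ : ∃ n, S.impulseTime (S.restart x) n ≤ t ∧
      t < S.impulseTime (S.restart x) (n + 1) := by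
    obtain ⟨m, hm⟩ := hS.exists_lt_impulseTime (S.restart x) t
    have hex : ∃ n, (t : ℝ≥0∞) < S.impulseTime (S.restart x) (n + 1) :=
      ⟨m, hm.trans_le (impulseTime_mono _ m.le_succ)⟩
    refine ⟨Nat.find hex, ?_, Nat.find_spec hex⟩
    rcases Nat.eq_zero_or_eq_succ_pred (Nat.find hex) with h0 | h0
    · rw [h0]
      simp [impulseTime]
    · rw [h0]
      exact not_lt.1 (Nat.find_min hex (Nat.lt_of_succ_le h0.ge))
  have hfin : S.impulseTime (S.restart x) n ≠ ∞ := (hn.trans_lt ENNReal.coe_lt_top).ne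
  rw [traj_eq hn hlt, traj_eq (n := n + 1)]
  · rw [impulseTime_succ, h, ENNReal.toNNReal_add ENNReal.coe_ne_top hfin, ENNReal.toNNReal_coe,
      add_tsub_add_eq_tsub_left, Function.iterate_succ_apply]
  · rw [impulseTime_succ, h, ENNReal.coe_add]
    gcongr
  · rw [impulseTime_succ, h, ENNReal.coe_add]
    exact ENNReal.add_lt_add_left ENNReal.coe_ne_top hlt

/-- Infinite lifetime puts only finitely many impulses before any given time, so one can induct on
their number, peeling off the first. -/
theorem Standing.traj_induction (hS : S.Standing) {P : X → ℝ≥0 → Prop}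
    (h1 : ∀ (x : X) (t : ℝ≥0), t < S.phi x → P x t)
    (h2 : ∀ x (c : ℝ≥0) t, S.phi x = c → P (S.restart x) t → P x (c + t)) (x : X) (t : ℝ≥0) :
    P x t := by
  obtain ⟨n, hn⟩ := hS.exists_lt_impulseTime x t
  induction n generalizing x t with
  | zero => simp [impulseTime] at hn
  | succ n ih =>
    by_cases h : (t : ℝ≥0∞) < S.phi x
    · exact h1 x t h
    · rw [not_lt] at h
      obtain ⟨c, hc⟩ := exists_coe_eq (h.trans_lt ENNReal.coe_lt_top).ne
      rw [← hc, ENNReal.coe_le_coe] at h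
      obtain ⟨u, rfl⟩ := exists_add_of_le h
      refine h2 x c u hc.symm (ih _ _ ?_)
      rw [impulseTime_succ, ← hc, ENNReal.coe_add] at hn
      exact (ENNReal.add_lt_add_iff_left ENNReal.coe_ne_top).1 hn

theorem Standing.traj_flow (hS : S.Standing) {x : X} {s : ℝ≥0} (hs : s < S.phi x) (u : ℝ≥0) :
    S.traj x (s + u) = S.traj (S.flow s x) u := by
  rcases eq_or_ne (S.phi x) ∞ with h | h
  · rw [traj_of_lt (by simp [h]), traj_of_lt (by simp [phi_flow_eq_top h]), add_comm,
      Flow.map_add]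
  · obtain ⟨a, ha⟩ := exists_coe_eq h
    rw [← ha, ENNReal.coe_lt_coe] at hs
    obtain ⟨c, rfl⟩ := exists_add_of_le hs.le
    have hs' : s < S.phi x := by rw [← ha]; exact_mod_cast hs
    have hc : S.phi x = s + c := by rw [← ha, ENNReal.coe_add]
    have hp := phi_flow hs' hc
    rcases lt_or_ge u c with hu | hu
    · rw [traj_of_lt (by rw [← ha]; exact_mod_cast (by gcongr : s + u < s + c)),
        traj_of_lt (by rw [hp]; exact_mod_cast hu), add_comm, Flow.map_add]
    · obtain ⟨v, rfl⟩ := exists_add_of_le hu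
      rw [hS.traj_add hp, ← add_assoc, hS.traj_add ha.symm, restart_flow hs' hc]

theorem Standing.traj_traj (hS : S.Standing) (x : X) (t u : ℝ≥0) :
    S.traj x (t + u) = S.traj (S.traj x t) u := by
  refine hS.traj_induction (P := fun x t => S.traj x (t + u) = S.traj (S.traj x t) u) ?_ ?_ x t
  · intro x t h
    rw [traj_of_lt h, hS.traj_flow h]
  · intro x c t h ih
    rw [add_assoc, hS.traj_add h, hS.traj_add h, ih]

theorem Standing.restart_notMem (hS : S.Standing) {x : X} {c : ℝ≥0} (h : S.phi x = c) :
    S.restart x ∉ S.M := by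
  intro hm
  have : S.restart x ∈ S.M ∩ range S.I := ⟨hm, _, (restart_of_phi_eq h).symm⟩
  rw [hS.disjoint] at this
  exact this

theorem Standing.traj_notMem (hS : S.Standing) (x : X) {t : ℝ≥0} (ht : 0 < t) :
    S.traj x t ∉ S.M := by
  -- Time `0` must be included for points off `M`: an impulse may occur exactly at the given time,
  -- leaving no time after the restart.
  suffices h : ∀ x t, (0 < t ∨ x ∉ S.M) → S.traj x t ∉ S.M from h x t (.inl ht)
  refine hS.traj_induction ?_ ?_
  · intro x t h h'
    rw [traj_of_lt h]
    rcases eq_zero_or_pos t with rfl | ht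
    · simpa using h'
    · exact flow_notMem_of_lt_phi ht h
  · intro x c t h ih _
    rw [hS.traj_add h]
    exact ih (.inr (hS.restart_notMem h))

theorem Standing.tendsto_traj_right (hS : S.Standing) (x : X) (t : ℝ≥0) :
    Tendsto (S.traj x) (𝓝[>] t) (𝓝 (S.traj x t)) := by
  have hsub : Tendsto (fun s : ℝ≥0 => s - t) (𝓝[>] t) (𝓝 0) := by
    have : Tendsto (fun s : ℝ≥0 => s - t) (𝓝 t) (𝓝 (t - t)) :=
      (continuous_id.sub continuous_const).tendsto t
    rw [tsub_self] at this
    exact this.mono_left nhdsWithin_le_nhds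
  have hflow : Tendsto (fun s => S.flow (s - t) (S.traj x t)) (𝓝[>] t) (𝓝 (S.traj x t)) := by
    have := ((S.flow.continuous continuous_id continuous_const :
      Continuous fun s => S.flow s (S.traj x t)).tendsto 0).comp hsub
    simpa [Function.comp_def] using this
  refine hflow.congr' ?_
  have hlt : ∀ᶠ s in 𝓝[>] t, ((s - t : ℝ≥0) : ℝ≥0∞) < S.phi (S.traj x t) :=
    (ENNReal.tendsto_coe.2 hsub).eventually (gt_mem_nhds (by simpa using phi_pos _))
  filter_upwards [hlt, self_mem_nhdsWithin] with s hs hts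
  rw [← traj_of_lt hs, ← hS.traj_traj, add_tsub_cancel_of_le (le_of_lt hts)]

theorem Standing.exists_compact_traj (hS : S.Standing) (x : X) (T : ℝ≥0) :
    ∃ C, IsCompact C ∧ ∀ t ≤ T, S.traj x t ∈ C := by
  have hc (x : X) : Continuous fun s => S.flow s x := S.flow.continuous continuous_id continuous_const
  refine hS.traj_induction (P := fun x T => ∃ C, IsCompact C ∧ ∀ t ≤ T, S.traj x t ∈ C) ?_ ?_ x T
  · intro x T h
    refine ⟨(fun s => S.flow s x) '' Icc 0 T, isCompact_Icc.image (hc x), fun t ht =>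
      ⟨t, ⟨zero_le, ht⟩, ?_⟩⟩
    rw [traj_of_lt]
    exact (ENNReal.coe_le_coe.2 ht).trans_lt h
  · rintro x c T h ⟨C, hC, hT⟩
    refine ⟨(fun s => S.flow s x) '' Icc 0 c ∪ C, (isCompact_Icc.image (hc x)).union hC,
      fun t ht => ?_⟩
    rcases lt_or_ge t c with htc | htc
    · refine .inl ⟨t, ⟨zero_le, htc.le⟩, ?_⟩
      rw [traj_of_lt]
      rw [h]
      exact_mod_cast htc
    · obtain ⟨u, rfl⟩ := exists_add_of_le htc
      right
      rw [hS.traj_add h]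
      exact hT u (le_of_add_le_add_left ht)

end Basic

/-! ### Continuity of `φ`, of restarting, and of the motion off impulse times -/

section Continuity

variable {X : Type*} [MetricSpace X] {S : ImpulsiveSystem X}

/-- Near a point of `M` the time `μ` of arrival in the bar of a tube is a continuous coordinate
along the motions, and `M` is reached where it takes the value `l`. -/
theorem Standing.exists_tube_time (hS : S.Standing) {m : X} (hm : m ∈ S.M) :
    ∃ (l : ℝ≥0) (μ : X → ℝ≥0), Tendsto μ (𝓝 m) (𝓝 l) ∧
      ∀ᶠ w in 𝓝 m, ∀ v a b, a + μ w = b + l → S.flow a v = w → S.flow b v ∈ S.M := by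
  classical
  obtain ⟨l, A, L, hl, -, hmA, hL, hFA, hnhds, hdisj, hA⟩ := hS.tube m hm
  choose! μ hμI hμL using fun w (hw : w ∈ S.F L (Icc 0 (2 * l))) => hw
  refine ⟨l, μ, ?_, ?_⟩
  · rw [tendsto_def]
    intro V hV
    obtain ⟨U, hUV, hU, hlU⟩ := mem_nhds_iff.1 hV
    -- `μ` is an arbitrary choice. It converges because disjointness of the slices keeps `m` out of
    -- the closed bar at all times of this compact set, and nearby points inherit this.
    have hK : IsCompact (Icc 0 (2 * l) \ U) := isCompact_Icc.diff hU
    have hoff : ∀ ν ∈ Icc 0 (2 * l) \ U, S.flow ν m ∉ L := by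
      intro ν hν hmem
      have hlL : m ∈ S.F L {l} := hFA ▸ hmA
      have hνL : m ∈ S.F L {ν} := ⟨ν, rfl, hmem⟩
      rcases lt_trichotomy ν l with h | rfl | h
      · exact (hdisj ν l h (by rw [two_mul]; exact le_add_self)).subset ⟨hνL, hlL⟩
      · exact hν.2 hlU
      · exact (hdisj l ν h hν.1.2).subset ⟨hlL, hνL⟩
    have hev : ∀ᶠ w in 𝓝 m, ∀ ν ∈ Icc 0 (2 * l) \ U, S.flow ν w ∉ L := by
      refine hK.eventually_forall_of_forall_eventually fun ν hν => ?_
      have hcont : Continuous fun q : X × ℝ≥0 => S.flow q.2 q.1 := continuous_flow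
      exact (hcont.tendsto (m, ν)).eventually (hL.isOpen_compl.mem_nhds (hoff ν hν))
    filter_upwards [hev, hnhds] with w hw hwt
    by_contra hc
    exact hw _ ⟨hμI w hwt, fun h => hc (hUV h)⟩ (hμL w hwt)
  · filter_upwards [hnhds] with w hw v a b hab hav
    have : S.flow b v ∈ S.F L {l} := by
      refine ⟨l, rfl, ?_⟩
      rw [← Flow.map_add, add_comm, ← hab, add_comm, Flow.map_add, hav]
      exact hμL w hw
    rw [hFA, hA] at this
    exact this.1

/-- Lower semicontinuity: the compact arc up to time `c` misses the closed set `M`. Time `0` belongs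
to the arc, hence the condition `z ∉ M`. -/
theorem eventually_lt_phi {z : X} (hz : z ∉ S.M) {c : ℝ≥0} (hc : c < S.phi z) :
    ∀ᶠ w in 𝓝 z, c < S.phi w := by
  have hev : ∀ᶠ w in 𝓝 z, ∀ s ∈ Icc 0 c, S.flow s w ∉ S.M := by
    refine isCompact_Icc.eventually_forall_of_forall_eventually fun s hs => ?_
    have hcont : Continuous fun q : X × ℝ≥0 => S.flow q.2 q.1 := continuous_flow
    refine (hcont.tendsto (z, s)).eventually (S.M_closed.isOpen_compl.mem_nhds ?_)
    rcases eq_zero_or_pos s with rfl | h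
    · simpa using hz
    · exact flow_notMem_of_lt_phi h ((ENNReal.coe_le_coe.2 hs.2).trans_lt hc)
  filter_upwards [hev] with w hw
  by_contra h
  rw [not_lt] at h
  obtain ⟨s, hs⟩ := exists_coe_eq (h.trans_lt ENNReal.coe_lt_top).ne
  refine hw s ⟨zero_le, ?_⟩ (flow_mem_of_phi_eq hs.symm)
  rw [← hs] at h
  exact_mod_cast h

/-- Upper semicontinuity is where the tube is needed: it forces a nearby motion to cross `M` at time
`s + μ - l`, which is close to `s`. -/
theorem Standing.eventually_phi_lt (hS : S.Standing) {z : X} {b : ℝ≥0∞} (hb : S.phi z < b) :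
    ∀ᶠ w in 𝓝 z, S.phi w < b := by
  obtain ⟨s, hs⟩ := exists_coe_eq (hb.trans_le le_top).ne
  have hs0 : 0 < s := phi_coe_pos hs.symm
  obtain ⟨l, μ, hμ, hM⟩ := hS.exists_tube_time (flow_mem_of_phi_eq hs.symm)
  have hfl : Tendsto (S.flow s) (𝓝 z) (𝓝 (S.flow s z)) :=
    (S.flow.continuous continuous_const continuous_id : Continuous fun w => S.flow s w).tendsto z
  have ht : Tendsto (fun w => s + μ (S.flow s w) - l) (𝓝 z) (𝓝 s) := by
    have : Tendsto (fun w => s + μ (S.flow s w) - l) (𝓝 z) (𝓝 (s + l - l)) :=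
      ((hμ.comp hfl).const_add s).sub tendsto_const_nhds
    simpa using this
  filter_upwards [hfl.eventually hM, ht.eventually (lt_mem_nhds hs0),
    (ENNReal.tendsto_coe.2 ht).eventually (gt_mem_nhds (hs ▸ hb))] with w h1 h2 h3
  exact (phi_le h2 (h1 w s _ (tsub_add_cancel_of_le (tsub_pos_iff_lt.1 h2).le).symm rfl)).trans_lt h3

theorem Standing.continuousAt_phi (hS : S.Standing) {z : X} (hz : z ∉ S.M) :
    ContinuousAt S.phi z := by
  refine tendsto_order.2 ⟨fun a ha => ?_, fun b hb => hS.eventually_phi_lt hb⟩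
  lift a to ℝ≥0 using (ha.trans_le le_top).ne
  exact eventually_lt_phi hz ha

/-- If the first impacts of the points `w a` with `M` converge to `m`, then their restarting points
converge to `I(m)`. -/
theorem tendsto_restart {α : Type*} {f : Filter α} {w : α → X} {c : α → ℝ≥0} {m : X}
    (hm : m ∈ S.M) (hc : ∀ᶠ a in f, S.phi (w a) = c a)
    (hw : Tendsto (fun a => S.flow (c a) (w a)) f (𝓝 m)) :
    Tendsto (fun a => S.restart (w a)) f (𝓝 (S.I ⟨m, hm⟩)) := by
  refine tendsto_iff_forall_eventually_mem.2 fun V hV => ?_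
  have := S.I_continuous.continuousAt.preimage_mem_nhds hV
  rw [nhds_subtype, mem_comap] at this
  obtain ⟨U, hU, hUV⟩ := this
  filter_upwards [hc, hw.eventually_mem hU] with a h1 h2
  rw [restart_of_phi_eq h1]
  exact hUV h2

theorem Standing.continuousAt_restart (hS : S.Standing) {z : X} (hz : z ∉ S.M) {c : ℝ≥0}
    (h : S.phi z = c) : ContinuousAt S.restart z := by
  have hp := hS.continuousAt_phi hz
  have hfin : ∀ᶠ w in 𝓝 z, S.phi w = (S.phi w).toNNReal := by
    filter_upwards [hp.eventually_ne (show S.phi z ≠ ∞ by simp [h])] with w hw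
    rw [ENNReal.coe_toNNReal hw]
  have ht : Tendsto (fun w => (S.phi w).toNNReal) (𝓝 z) (𝓝 c) := by
    have := (ENNReal.tendsto_toNNReal (a := S.phi z) (by simp [h])).comp hp
    simpa [h, Function.comp_def] using this
  have := tendsto_restart (flow_mem_of_phi_eq h) hfin
    ((continuous_flow.tendsto (z, c)).comp (tendsto_id.prodMk_nhds ht))
  rwa [← restart_of_phi_eq h] at this

theorem continuousAt_traj_of_lt {z : X} (hz : z ∉ S.M) {s : ℝ≥0} (hs : s < S.phi z) :
    ContinuousAt (fun q : X × ℝ≥0 => S.traj q.1 q.2) (z, s) := by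
  refine (continuous_flow (S := S)).continuousAt.congr ?_
  obtain ⟨c, h1, h2⟩ := ENNReal.lt_iff_exists_nnreal_btwn.1 hs
  rw [nhds_prod_eq]
  filter_upwards [(eventually_lt_phi hz h2).prod_mk
    (gt_mem_nhds (ENNReal.coe_lt_coe.1 h1))] with q hq
  exact (traj_of_lt ((ENNReal.coe_lt_coe.2 hq.2).trans hq.1)).symm

/-- Continuity may fail at impulse times, but these do not accumulate from the right. Once the first
impulse is past, the motion factors through restarting, which is continuous off `M`. -/
theorem Standing.eventually_continuousAt_traj (hS : S.Standing) {z : X} (hz : z ∉ S.M)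
    (t : ℝ≥0) :
    ∀ᶠ s in 𝓝[>] t, ContinuousAt (fun q : X × ℝ≥0 => S.traj q.1 q.2) (z, s) := by
  revert hz
  refine hS.traj_induction (P := fun z t => z ∉ S.M →
    ∀ᶠ s in 𝓝[>] t, ContinuousAt (fun q : X × ℝ≥0 => S.traj q.1 q.2) (z, s)) ?_ ?_ z t
  · intro z t h hz
    have : ∀ᶠ s : ℝ≥0 in 𝓝[>] t, (s : ℝ≥0∞) < S.phi z :=
      nhdsWithin_le_nhds (ENNReal.continuous_coe.continuousAt.eventually (gt_mem_nhds h))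
    filter_upwards [this] with s hs using continuousAt_traj_of_lt hz hs
  · intro z c t h ih hz
    have hsub : Tendsto (fun s : ℝ≥0 => s - c) (𝓝[>] (c + t)) (𝓝[>] t) := by
      refine tendsto_nhdsWithin_iff.2 ⟨?_, ?_⟩
      · have : Tendsto (fun s : ℝ≥0 => s - c) (𝓝 (c + t)) (𝓝 (c + t - c)) :=
          (continuous_id.sub continuous_const).tendsto _
        rw [add_tsub_cancel_left] at this
        exact this.mono_left nhdsWithin_le_nhds
      · filter_upwards [self_mem_nhdsWithin] with s hs
        exact lt_tsub_iff_left.2 (mem_Ioi.1 hs)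
    filter_upwards [hsub.eventually (ih (hS.restart_notMem h)), self_mem_nhdsWithin] with s hs hcs
    have hcs' : c < s := lt_of_le_of_lt le_self_add hcs
    have hp := hS.continuousAt_phi hz
    have ht : Tendsto (fun w => (S.phi w).toNNReal) (𝓝 z) (𝓝 c) := by
      have := (ENNReal.tendsto_toNNReal (a := S.phi z) (by simp [h])).comp hp
      simpa [h, Function.comp_def] using this
    have hmap : Tendsto (fun q : X × ℝ≥0 => (S.restart q.1, q.2 - (S.phi q.1).toNNReal))
        (𝓝 (z, s)) (𝓝 (S.restart z, s - c)) :=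
      ((hS.continuousAt_restart hz h).tendsto.comp (continuous_fst.tendsto (z, s))).prodMk_nhds
        ((continuous_snd.tendsto (z, s)).sub (ht.comp (continuous_fst.tendsto (z, s))))
    have hlim := hs.tendsto.comp hmap
    have heq : S.traj (S.restart z) (s - c) = S.traj z s := by
      rw [← hS.traj_add h, add_tsub_cancel_of_le hcs'.le]
    rw [ContinuousAt]
    simp only [heq] at hlim ⊢
    refine hlim.congr' ?_
    obtain ⟨b, hb1, hb2⟩ := exists_between hcs'
    have hlt : ∀ᶠ w in 𝓝 z, S.phi w < b :=
      hS.eventually_phi_lt (by rw [h]; exact_mod_cast hb1)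
    rw [nhds_prod_eq]
    filter_upwards [hlt.prod_mk (lt_mem_nhds hb2)] with q hq
    obtain ⟨d, hd⟩ := exists_coe_eq (hq.1.trans_le le_top).ne
    have hdq : d ≤ q.2 := by
      have := hq.1
      rw [← hd] at this
      exact ((ENNReal.coe_lt_coe.1 this).trans hq.2).le
    simp only [Function.comp_apply]
    rw [← hd, ENNReal.toNNReal_coe, ← hS.traj_add hd.symm, add_tsub_cancel_of_le hdq]

/-- Motions that undergo an impulse within a vanishing time approach the range of the impulse
function. -/
theorem Standing.exists_tendsto_traj_range (hS : S.Standing) {w : ℕ → X} {a : X} {d : ℕ → ℝ≥0}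
    (hw : Tendsto w atTop (𝓝 a)) (hd : Tendsto d atTop (𝓝 0)) (hle : ∀ n, S.phi (w n) ≤ d n) :
    ∃ b ∈ range S.I, Tendsto (fun n => S.traj (w n) (d n)) atTop (𝓝 b) := by
  choose c hc using fun n => exists_coe_eq ((hle n).trans_lt ENNReal.coe_lt_top).ne
  have hcd (n) : c n ≤ d n := by
    have := hle n
    rw [← hc n] at this
    exact_mod_cast this
  have hc0 : Tendsto c atTop (𝓝 0) :=
    tendsto_of_tendsto_of_tendsto_of_le_of_le tendsto_const_nhds hd (fun _ => zero_le) hcd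
  have hfl : Tendsto (fun n => S.flow (c n) (w n)) atTop (𝓝 a) := by
    have := (continuous_flow (S := S)).tendsto (a, 0) |>.comp (hw.prodMk_nhds hc0)
    simpa [Function.comp_def] using this
  have ha : a ∈ S.M := S.M_closed.mem_of_tendsto hfl
    (.of_forall fun n => flow_mem_of_phi_eq (hc n).symm)
  have hr := tendsto_restart ha (.of_forall fun n => (hc n).symm) hfl
  refine ⟨S.I ⟨a, ha⟩, ⟨_, rfl⟩, ?_⟩
  have hI : S.I ⟨a, ha⟩ ∉ S.M := fun h =>
    hS.disjoint.subset ⟨h, mem_range_self _⟩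
  have hsub : Tendsto (fun n => d n - c n) atTop (𝓝 0) := by simpa using hd.sub hc0
  have := (continuousAt_traj_of_lt hI (s := 0) (by simpa using phi_pos _)).tendsto.comp
    (hr.prodMk_nhds hsub)
  simp only [traj_zero] at this
  refine this.congr fun n => ?_
  simp only [Function.comp_apply]
  rw [← hS.traj_add (hc n).symm, add_tsub_cancel_of_le (hcd n)]

end Continuity

/-! ### Limits of motions, and recurrence of almost periodic points -/

section Limits

variable {X : Type*} [MetricSpace X] {S : ImpulsiveSystem X}

/-- Every sequence of times tending to infinity has a subsequence along which the motion of `z`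
converges. -/
def IsLagrangeStable (S : ImpulsiveSystem X) (z : X) : Prop :=
  ∀ u : ℕ → ℝ≥0, Tendsto u atTop atTop →
    ∃ a, ∃ ψ : ℕ → ℕ, StrictMono ψ ∧ Tendsto (fun n => S.traj z (u (ψ n))) atTop (𝓝 a)

/-- A limit of the motion along a sequence of times at which the motion is asymptotically
right-continuous does not belong to `M`. -/
theorem Standing.limit_notMem (hS : S.Standing) {z q : X} (hz : S.IsLagrangeStable z)
    {u : ℕ → ℝ≥0} (hu : Tendsto u atTop atTop)
    (hq : Tendsto (fun n => S.traj z (u n)) atTop (𝓝 q))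
    (hcont : ∀ d : ℕ → ℝ≥0, Tendsto d atTop (𝓝 0) →
      Tendsto (fun n => S.traj z (u n + d n)) atTop (𝓝 q)) : q ∉ S.M := by
  intro hqM
  have hrange : q ∉ range S.I := fun h => hS.disjoint.subset ⟨hqM, h⟩
  obtain ⟨l, μ, hμ, hM⟩ := hS.exists_tube_time hqM
  have hμu := hμ.comp hq
  have hMu := hq.eventually hM
  have hpos := hu.eventually (eventually_gt_atTop 0)
  -- Here the orbit points lie, infinitely often, on the exit side of `M` in the tube, and one looks
  -- backwards by the time `l - μ`.
  by_cases hfreq : ∃ᶠ n in atTop, μ (S.traj z (u n)) < l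
  · have hback : Tendsto (fun n => l - μ (S.traj z (u n))) atTop (𝓝 0) := by
      simpa using (tendsto_const_nhds (x := l)).sub hμu
    obtain ⟨ψ, hψ, hψP⟩ := extraction_of_frequently_atTop
      (hfreq.and_eventually (hMu.and ((hback.eventually (gt_mem_nhds one_pos)).and
        (hu.eventually (eventually_gt_atTop 1)))))
    set d := fun n => l - μ (S.traj z (u n)) with hd
    have hdu (n) : d (ψ n) < u (ψ n) := (hψP n).2.2.1.trans (hψP n).2.2.2
    have hv : Tendsto (fun n => u (ψ n) - d (ψ n)) atTop atTop := by
      have h1 : Tendsto (fun n => u (ψ n) - 1) atTop atTop := by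
        refine tendsto_atTop.2 fun b => ?_
        filter_upwards [(hu.comp hψ.tendsto_atTop).eventually (eventually_ge_atTop (b + 1))] with n h
        exact le_tsub_of_add_le_right h
      exact tendsto_atTop_mono (fun n => tsub_le_tsub_left (hψP n).2.2.1.le _) h1
    -- The points reached by going back need not converge; Lagrange stability supplies a subsequence
    -- along which they do.
    obtain ⟨a, χ, hχ, ha⟩ := hz _ hv
    have htraj (n) : S.traj (S.traj z (u (ψ n) - d (ψ n))) (d (ψ n)) = S.traj z (u (ψ n)) := by
      rw [← hS.traj_traj, tsub_add_cancel_of_le (hdu n).le]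
    obtain ⟨b, hb, hlim⟩ := hS.exists_tendsto_traj_range ha
      -- Without an impulse in the last `d`, the orbit would follow the flow through the tube and so
      -- start in `M`, which is impossible at a positive time.
      (hback.comp (hψ.tendsto_atTop.comp hχ.tendsto_atTop)) (fun n => by
        by_contra h
        replace h : (d (ψ (χ n)) : ℝ≥0∞) < _ := not_le.1 h
        have h1 := htraj (χ n)
        rw [traj_of_lt h] at h1
        have h2 := (hψP (χ n)).2.1 _ (d (ψ (χ n))) 0
          (by rw [zero_add]; exact tsub_add_cancel_of_le (hψP (χ n)).1.le) h1
        rw [Flow.map_zero_apply] at h2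
        exact hS.traj_notMem z (tsub_pos_of_lt (hdu _)) h2)
    have hlim' : Tendsto (fun n => S.traj z (u (ψ (χ n)))) atTop (𝓝 b) :=
      hlim.congr fun n => htraj (χ n)
    have := tendsto_nhds_unique hlim' (hq.comp (hψ.tendsto_atTop.comp hχ.tendsto_atTop))
    exact hrange (this ▸ hb)
  -- Now the points lie on the entry side of `M`, so an impulse follows within `μ - l`. The limit in
  -- the range of `I` contradicts `hcont` for this delay.
  · rw [not_frequently] at hfreq
    have hd : Tendsto (fun n => μ (S.traj z (u n)) - l) atTop (𝓝 0) := by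
      simpa using hμu.sub (tendsto_const_nhds (x := l))
    obtain ⟨N, hN⟩ := eventually_atTop.1 (hfreq.and (hMu.and hpos))
    have hshift : Tendsto (fun n => n + N) atTop atTop := tendsto_add_atTop_nat N
    obtain ⟨b, hb, hlim⟩ := hS.exists_tendsto_traj_range (hq.comp hshift) (hd.comp hshift)
      (fun n => by
        obtain ⟨h1, h2, h3⟩ := hN (n + N) (Nat.le_add_left _ _)
        have h4 := h2 _ 0 (μ (S.traj z (u (n + N))) - l)
          (by rw [zero_add, tsub_add_cancel_of_le (not_lt.1 h1)]) (Flow.map_zero_apply _ _)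
        refine phi_le (pos_iff_ne_zero.2 fun h0 => ?_) h4
        simp only [Function.comp_apply] at h0
        rw [h0, Flow.map_zero_apply] at h4
        exact hS.traj_notMem z h3 h4)
    have hlim' : Tendsto (fun n => S.traj z (u (n + N) + (μ (S.traj z (u (n + N))) - l)))
        atTop (𝓝 b) := hlim.congr fun n => (hS.traj_traj _ _ _).symm
    have := tendsto_nhds_unique hlim' ((hcont _ hd).comp hshift)
    exact hrange (this ▸ hb)

theorem IsStationary.isAlmostPeriodic {p : X} (h : S.IsStationary p) : S.IsAlmostPeriodic p := by
  intro ε hε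
  refine ⟨1, one_pos, fun α => ⟨α + 1, ⟨le_self_add, le_rfl⟩, by positivity, fun t => ?_⟩⟩
  rwa [h, h, dist_self]

theorem IsPeriodic.isAlmostPeriodic (hS : S.Standing) {p : X} (h : S.IsPeriodic p) :
    S.IsAlmostPeriodic p := by
  obtain ⟨τ, hτ, hp⟩ := h
  have hmul : ∀ n : ℕ, S.traj p (n * τ) = p := by
    intro n
    induction n with
    | zero => simp [traj_zero]
    | succ n ih => rw [Nat.cast_succ, add_mul, one_mul, hS.traj_traj, ih, hp]
  intro ε hε
  refine ⟨τ, hτ, fun α => ?_⟩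
  have hlt := Nat.lt_floor_add_one (α / τ)
  have hle := Nat.floor_le (zero_le : 0 ≤ α / τ)
  rw [div_lt_iff₀ hτ] at hlt
  rw [le_div_iff₀ hτ] at hle
  refine ⟨((⌊α / τ⌋₊ + 1 : ℕ) : ℝ≥0) * τ, ⟨?_, ?_⟩, by positivity, fun t => ?_⟩
  · rw [Nat.cast_succ]
    exact hlt.le
  · rw [Nat.cast_succ, add_mul, one_mul]
    gcongr
  · rwa [add_comm, hS.traj_traj, hmul, dist_self]

/-- Every orbit point is within `ε / 2` of the initial arc over `[0, T]`: go back by an almost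
period chosen in `[t - T, t]`. That arc lies in a compact set, although it may have jumps. -/
theorem IsAlmostPeriodic.isCompact_closure [CompleteSpace X] (hS : S.Standing) {p : X}
    (h : S.IsAlmostPeriodic p) : IsCompact (closure (range (S.traj p))) := by
  refine TotallyBounded.isCompact_of_isClosed ?_ isClosed_closure
  refine TotallyBounded.closure (Metric.totallyBounded_iff.2 fun ε hε => ?_)
  obtain ⟨T, -, hT⟩ := h (ε / 2) (by positivity)
  obtain ⟨C, hC, hCT⟩ := hS.exists_compact_traj p T
  obtain ⟨A, hA, hCA⟩ := Metric.totallyBounded_iff.1 hC.totallyBounded (ε / 2) (by positivity)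
  refine ⟨A, hA, ?_⟩
  rintro _ ⟨t, rfl⟩
  obtain ⟨s, hs, hst⟩ : ∃ s ≤ T, dist (S.traj p t) (S.traj p s) < ε / 2 := by
    rcases le_total t T with htT | htT
    · exact ⟨t, htT, by rw [dist_self]; positivity⟩
    · obtain ⟨τ, ⟨h1, h2⟩, -, h3⟩ := hT (t - T)
      rw [tsub_add_cancel_of_le htT] at h2
      refine ⟨t - τ, tsub_le_iff_tsub_le.1 h1, ?_⟩
      have := h3 (t - τ)
      rwa [tsub_add_cancel_of_le h2] at this
  have hsC := hCA (hCT s hs)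
  simp only [mem_iUnion, Metric.mem_ball] at hsC ⊢
  obtain ⟨a, ha, hsa⟩ := hsC
  exact ⟨a, ha, (dist_triangle _ _ _).trans_lt (by linarith)⟩

theorem IsAlmostPeriodic.exists_seq {p : X} (h : S.IsAlmostPeriodic p) :
    ∃ τ : ℕ → ℝ≥0, Tendsto τ atTop atTop ∧
      ∀ t : ℕ → ℝ≥0, Tendsto (fun n => dist (S.traj p (t n + τ n)) (S.traj p (t n))) atTop
        (𝓝 0) := by
  have : ∀ n : ℕ, ∃ τ : ℝ≥0, (n : ℝ≥0) ≤ τ ∧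
      ∀ t, dist (S.traj p (t + τ)) (S.traj p t) < 1 / ((n : ℝ) + 1) := by
    intro n
    obtain ⟨T, -, hT⟩ := h (1 / ((n : ℝ) + 1)) (by positivity)
    obtain ⟨τ, h1, -, h2⟩ := hT n
    exact ⟨τ, h1.1, h2⟩
  choose τ h1 h2 using this
  refine ⟨τ, tendsto_atTop_mono h1 tendsto_natCast_atTop_atTop, fun t => ?_⟩
  exact squeeze_zero (fun _ => dist_nonneg) (fun n => (h2 n _).le)
    tendsto_one_div_add_atTop_nhds_zero_nat

end Limits

end ImpulsiveSystem

/-! ### Transfer of asymptotic behaviour from `x` to `y` -/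

section Comparison

open ImpulsiveSystem

variable {X Y : Type*} [MetricSpace X] [MetricSpace Y] {SX : ImpulsiveSystem X}
  {SY : ImpulsiveSystem Y} {x : X} {y : Y}

theorem ComparableInLimit.isLagrangeStable (hxy : ComparableInLimit SX SY y x)
    (hx : SX.IsLagrangeStable x) : SY.IsLagrangeStable y := by
  intro u hu
  obtain ⟨a, ψ, hψ, ha⟩ := hx u hu
  obtain ⟨b, hb, -⟩ := mem_iUnion.1
    (hxy (mem_iUnion.2 ⟨a, ha, hu.comp hψ.tendsto_atTop⟩ : u ∘ ψ ∈ SX.convSeq x))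
  exact ⟨b, ψ, hψ, hb⟩

/-- A failure would give times `t n, s n → ∞` with the positions of `x` merging and those of `y`
staying apart. On a subsequence both positions of `x` share a limit, so the interleaved sequence
lies in `𝓛_x`; convergence of `y` along it is a contradiction. -/
theorem ComparableInLimit.uniform (hxy : ComparableInLimit SX SY y x)
    (hx : SX.IsLagrangeStable x) {ε : ℝ} (hε : 0 < ε) :
    ∃ δ > 0, ∃ T, ∀ t ≥ T, ∀ s ≥ T, dist (SX.traj x t) (SX.traj x s) < δ →
      dist (SY.traj y t) (SY.traj y s) < ε := by
  by_contra! hcon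
  choose t ht s hs hxd hyd using fun n : ℕ =>
    hcon (1 / ((n : ℝ) + 1)) Nat.one_div_pos_of_nat (n : ℝ≥0)
  have htt : Tendsto t atTop atTop := tendsto_atTop_mono ht tendsto_natCast_atTop_atTop
  have hst : Tendsto s atTop atTop := tendsto_atTop_mono hs tendsto_natCast_atTop_atTop
  obtain ⟨a, ψ, hψ, ha⟩ := hx t htt
  have hdist : Tendsto (fun n => dist (SX.traj x (t n)) (SX.traj x (s n))) atTop (𝓝 0) :=
    squeeze_zero (fun _ => dist_nonneg) (fun n => (hxd n).le)
      tendsto_one_div_add_atTop_nhds_zero_nat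
  have hb : Tendsto (fun n => SX.traj x (s (ψ n))) atTop (𝓝 a) :=
    ha.congr_dist (hdist.comp hψ.tendsto_atTop)
  have hhalf : Tendsto (fun n : ℕ => n / 2) atTop atTop := Nat.tendsto_div_const_atTop two_ne_zero
  have hhalfψ := hψ.tendsto_atTop.comp hhalf
  let v : ℕ → ℝ≥0 := fun n => if Even n then t (ψ (n / 2)) else s (ψ (n / 2))
  have hv : v ∈ SX.convSeq x := by
    refine mem_iUnion.2 ⟨a, ?_, ?_⟩
    · have := Tendsto.if' (p := fun n : ℕ => Even n) (ha.comp hhalf) (hb.comp hhalf)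
      refine this.congr fun n => ?_
      by_cases h : Even n <;> simp [v, h]
    · exact Tendsto.if' (htt.comp hhalfψ) (hst.comp hhalfψ)
  obtain ⟨b, hvb, -⟩ := mem_iUnion.1 (hxy hv)
  have hyt : Tendsto (fun n => SY.traj y (t (ψ n))) atTop (𝓝 b) := by
    have := hvb.comp (tendsto_id.nsmul_atTop two_pos : Tendsto (fun n : ℕ => 2 • n) atTop atTop)
    refine this.congr fun n => ?_
    simp [v]
  have hys : Tendsto (fun n => SY.traj y (s (ψ n))) atTop (𝓝 b) := by
    have := hvb.comp ((tendsto_add_atTop_nat 1).comp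
      (tendsto_id.nsmul_atTop two_pos : Tendsto (fun n : ℕ => 2 • n) atTop atTop))
    refine this.congr fun n => ?_
    have h2 : (2 * n + 1) / 2 = n := by omega
    simp [v, h2]
  have hlim := hyt.dist hys
  rw [dist_self] at hlim
  exact absurd (ge_of_tendsto hlim (.of_forall fun n => hyd (ψ n))) (not_le.2 hε)

theorem ComparableInLimit.tendsto_dist (hxy : ComparableInLimit SX SY y x)
    (hx : SX.IsLagrangeStable x) {t s : ℕ → ℝ≥0} (ht : Tendsto t atTop atTop)
    (hs : Tendsto s atTop atTop)
    (h : Tendsto (fun n => dist (SX.traj x (t n)) (SX.traj x (s n))) atTop (𝓝 0)) :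
    Tendsto (fun n => dist (SY.traj y (t n)) (SY.traj y (s n))) atTop (𝓝 0) := by
  rw [Metric.tendsto_atTop']
  intro ε hε
  obtain ⟨δ, hδ, T, hT⟩ := hxy.uniform hx hε
  have := (ht.eventually (eventually_ge_atTop T)).and
    ((hs.eventually (eventually_ge_atTop T)).and (h.eventually (gt_mem_nhds hδ)))
  obtain ⟨N, hN⟩ := eventually_atTop.1 this
  refine ⟨N, fun n hn => ?_⟩
  obtain ⟨h1, h2, h3⟩ := hN n hn.le
  simpa using hT _ h1 _ h2 h3

/-- The uniform estimate serves all three cases of the theorem, since rest, periods and almost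
periods are each expressed by distances along one orbit. -/
theorem ComparableInLimit.exists_asymptotic [CompleteSpace X] (hxy : ComparableInLimit SX SY y x)
    (hX : SX.Standing) (hY : SY.Standing) {p : X} (hp : SX.IsAlmostPeriodic p)
    (hxp : SX.IsAsymptoticTo x p) :
    ∃ q, SY.IsAsymptoticTo y q ∧ ∀ ε > 0, ∃ δ > 0, ∀ s s',
      dist (SX.traj p s) (SX.traj p s') < δ → dist (SY.traj q s) (SY.traj q s') < ε := by
  obtain ⟨g, hg0, hg⟩ := hxp
  have hK := hp.isCompact_closure hX
  have hpL : SX.IsLagrangeStable p := fun u _ => by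
    obtain ⟨a, -, ψ, hψ, ha⟩ := hK.tendsto_subseq (x := fun n => SX.traj p (u n))
      fun n => subset_closure (mem_range_self _)
    exact ⟨a, ψ, hψ, ha⟩
  have hxL : SX.IsLagrangeStable x := fun u hu => by
    obtain ⟨a, -, ψ, hψ, ha⟩ := hK.tendsto_subseq (x := fun n => SX.traj p (g (u n)))
      fun n => subset_closure (mem_range_self _)
    refine ⟨a, ψ, hψ, ha.congr_dist ?_⟩
    simpa only [dist_comm, Function.comp_def] using hg.comp (hu.comp hψ.tendsto_atTop)
  have hyL := hxy.isLagrangeStable hxL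
  obtain ⟨τ, hτ, hτp⟩ := hp.exists_seq
  have hginv : Tendsto g.symm atTop atTop := by
    have := g.symm.isClosedEmbedding.tendsto_cocompact
    rwa [cocompact_eq_atTop] at this
  have hu : Tendsto (fun n => g.symm (τ n)) atTop atTop := hginv.comp hτ
  set u := fun n => g.symm (τ n) with hu_def
  have hpM : p ∉ SX.M := by
    have hlim (d : ℕ → ℝ≥0) (hd : Tendsto d atTop (𝓝 0)) :
        Tendsto (fun n => SX.traj p (τ n + d n)) atTop (𝓝 p) := by
      have hpd : Tendsto (fun n => SX.traj p (d n)) atTop (𝓝 p) := by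
        have h0 : ContinuousWithinAt (SX.traj p) (Ioi 0) 0 := hX.tendsto_traj_right p 0
        have h1 : ContinuousAt (SX.traj p) 0 := by
          have := continuousWithinAt_Ioi_iff_Ici.1 h0
          rwa [ContinuousWithinAt, show (Ici (0 : ℝ≥0)) = univ from Ici_bot, nhdsWithin_univ] at this
        have := h1.tendsto.comp hd
        rwa [traj_zero] at this
      -- The delay `d n` varies with `n`, so the uniformity of almost periods in the time variable
      -- is essential.
      refine hpd.congr_dist ?_
      simpa only [dist_comm, add_comm] using hτp d
    refine hX.limit_notMem hpL hτ ?_ hlim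
    simpa using hlim (fun _ => 0) tendsto_const_nhds
  have hxu : Tendsto (fun n => SX.traj x (u n)) atTop (𝓝 p) := by
    have h1 : Tendsto (fun n => SX.traj p (τ n)) atTop (𝓝 p) := by
      have := hτp (fun _ => 0)
      simp only [zero_add, traj_zero] at this
      exact tendsto_iff_dist_tendsto_zero.2 this
    refine h1.congr_dist ?_
    have := hg.comp hu
    simpa [Function.comp_def, hu_def, dist_comm] using this
  obtain ⟨q, hq, -⟩ := mem_iUnion.1 (hxy (mem_iUnion.2 ⟨p, hxu, hu⟩ : u ∈ SX.convSeq x))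
  -- Since `p ∉ M`, small delays do not disturb the convergence of `x` to `p`, and comparability
  -- passes this on to `y`.
  have hqM : q ∉ SY.M := by
    refine hY.limit_notMem hyL hu hq fun d hd => ?_
    have h1 : Tendsto (fun n => SX.traj x (u n + d n)) atTop (𝓝 p) := by
      have := (continuousAt_traj_of_lt hpM (s := 0) (by simpa using phi_pos _)).tendsto.comp
        (hxu.prodMk_nhds hd)
      simp only [traj_zero] at this
      exact this.congr fun n => (hX.traj_traj _ _ _).symm
    have h2 := hxu.dist h1
    rw [dist_self] at h2
    exact hq.congr_dist (hxy.tendsto_dist hxL hu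
      (tendsto_atTop_mono (fun n => le_self_add) hu) h2)
  have hright (t : ℝ≥0) : ∀ᶠ s in 𝓝[>] t,
      Tendsto (fun n => SX.traj x (u n + s)) atTop (𝓝 (SX.traj p s)) ∧
      Tendsto (fun n => SY.traj y (u n + s)) atTop (𝓝 (SY.traj q s)) := by
    filter_upwards [hX.eventually_continuousAt_traj hpM t,
      hY.eventually_continuousAt_traj hqM t] with s h1 h2
    constructor
    · exact (h1.tendsto.comp (hxu.prodMk_nhds tendsto_const_nhds)).congr
        fun n => (hX.traj_traj _ _ _).symm
    · exact (h2.tendsto.comp (hq.prodMk_nhds tendsto_const_nhds)).congr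
        fun n => (hY.traj_traj _ _ _).symm
  have hu' (s : ℝ≥0) : Tendsto (fun n => u n + s) atTop atTop :=
    tendsto_atTop_mono (fun n => le_self_add) hu
  refine ⟨q, ⟨g, hg0, ?_⟩, ?_⟩
  · refine Metric.tendsto_nhds.2 fun ε hε => ?_
    obtain ⟨δ, hδ, T, hT⟩ := hxy.uniform hxL (half_pos hε)
    filter_upwards [eventually_ge_atTop T, hg.eventually (gt_mem_nhds hδ)] with t ht hgt
    have hpt := hX.tendsto_traj_right p (g t)
    -- For `s` just to the right of `g t`, compare `y(t)` with `y(u n + s)` and let `n → ∞`; then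
    -- let `s` decrease to `g t`.
    have hle : ∀ᶠ s in 𝓝[>] (g t), dist (SY.traj y t) (SY.traj q s) ≤ ε / 2 := by
      filter_upwards [hright (g t), (tendsto_const_nhds (x := SX.traj x t) |>.dist hpt).eventually (gt_mem_nhds hgt)]
        with s hs hd
      refine le_of_tendsto (tendsto_const_nhds.dist hs.2) ?_
      filter_upwards [(tendsto_const_nhds.dist hs.1).eventually (gt_mem_nhds hd),
        (hu' s).eventually (eventually_ge_atTop T)] with n h1 h2
      exact (hT _ ht _ h2 h1).le
    have := le_of_tendsto (tendsto_const_nhds.dist (hY.tendsto_traj_right q (g t))) hle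
    rw [Real.dist_0_eq_abs, abs_of_nonneg dist_nonneg]
    linarith
  · intro ε hε
    obtain ⟨δ, hδ, T, hT⟩ := hxy.uniform hxL (half_pos hε)
    refine ⟨δ, hδ, fun s s' hss => ?_⟩
    have hpair : Tendsto (fun r : ℝ≥0 × ℝ≥0 => dist (SX.traj p r.1) (SX.traj p r.2))
        (𝓝[>] s ×ˢ 𝓝[>] s') (𝓝 (dist (SX.traj p s) (SX.traj p s'))) :=
      ((hX.tendsto_traj_right p s).comp tendsto_fst).dist
        ((hX.tendsto_traj_right p s').comp tendsto_snd)
    have hpairq : Tendsto (fun r : ℝ≥0 × ℝ≥0 => dist (SY.traj q r.1) (SY.traj q r.2))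
        (𝓝[>] s ×ˢ 𝓝[>] s') (𝓝 (dist (SY.traj q s) (SY.traj q s'))) :=
      ((hY.tendsto_traj_right q s).comp tendsto_fst).dist
        ((hY.tendsto_traj_right q s').comp tendsto_snd)
    refine (le_of_tendsto hpairq ?_).trans_lt (half_lt_self hε)
    -- Both times are shifted to the right independently, off the impulse times of `p` and `q`,
    -- while the distance along `p` stays below `δ`.
    filter_upwards [(hright s).prod_mk (hright s'), hpair.eventually (gt_mem_nhds hss)] with r hr hd
    refine le_of_tendsto (hr.1.2.dist hr.2.2) ?_
    filter_upwards [(hr.1.1.dist hr.2.1).eventually (gt_mem_nhds hd),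
      (hu' r.1).eventually (eventually_ge_atTop T),
      (hu' r.2).eventually (eventually_ge_atTop T)] with n h1 h2 h3
    exact (hT _ h2 _ h3 h1).le

end Comparison

theorem theorem4p18 {X Y : Type*} [MetricSpace X] [MetricSpace Y] [CompleteSpace X]
    (SX : ImpulsiveSystem X) (SY : ImpulsiveSystem Y)
    (hX : SX.Standing) (hY : SY.Standing) (x : X) (y : Y)
    (hxy : ComparableInLimit SX SY y x) :
    (SX.IsAsymptoticallyAlmostPeriodic x → SY.IsAsymptoticallyAlmostPeriodic y) ∧
    (SX.IsAsymptoticallyStationary x → SY.IsAsymptoticallyStationary y) ∧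
    (SX.IsAsymptoticallyPeriodic x → SY.IsAsymptoticallyPeriodic y) := by
  refine ⟨?_, ?_, ?_⟩
  · rintro ⟨p, hp, hxp⟩
    obtain ⟨q, hyq, huc⟩ := hxy.exists_asymptotic hX hY hp hxp
    refine ⟨q, fun ε hε => ?_, hyq⟩
    obtain ⟨δ, hδ, h⟩ := huc ε hε
    obtain ⟨T, hT0, hT⟩ := hp δ hδ
    refine ⟨T, hT0, fun α => ?_⟩
    obtain ⟨τ, hτ, hτ0, hpτ⟩ := hT α
    exact ⟨τ, hτ, hτ0, fun t => h _ _ (hpτ t)⟩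
  · rintro ⟨p, hp, hxp⟩
    obtain ⟨q, hyq, huc⟩ := hxy.exists_asymptotic hX hY hp.isAlmostPeriodic hxp
    refine ⟨q, fun t => ?_, hyq⟩
    -- As `p` is at rest, distances along its orbit vanish and are below every `δ`, so distances
    -- along that of `q` are below every `ε`.
    refine eq_of_forall_dist_le fun ε hε => ?_
    obtain ⟨δ, hδ, h⟩ := huc ε hε
    have := h t 0 (by rwa [hp, hp, dist_self])
    rw [ImpulsiveSystem.traj_zero] at this
    exact this.le
  · rintro ⟨p, hp, hxp⟩
    obtain ⟨q, hyq, huc⟩ := hxy.exists_asymptotic hX hY (hp.isAlmostPeriodic hX) hxp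
    obtain ⟨τ, hτ0, hτ⟩ := hp
    refine ⟨q, ⟨τ, hτ0, eq_of_forall_dist_le fun ε hε => ?_⟩, hyq⟩
    obtain ⟨δ, hδ, h⟩ := huc ε hε
    have := h τ 0 (by rwa [hτ, ImpulsiveSystem.traj_zero, dist_self])
    rw [ImpulsiveSystem.traj_zero] at this
    exact this.le
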